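/- **Conventions.** For $f,\varphi\in L^2(\mathbb R)$ and $z=(x,\omega)\in\mathbb R^2$ let $\pi(z)\varphi(t)=\varphi(t-x)e^{2\pi i\omega t}$ and let $V_\varphi f(z)=\int_{\mathbb R} f(t)\overline{\varphi(t-x)}e^{-2\pi i\omega t}\,dt$ be the short-time Fourier transform. For a compact set $\Omega\subset\mathbb R^2$ and $\|\varphi\|_2=1$ let $H_{\Omega,\varphi}f=\iint_\Omega V_\varphi f(z)\,\pi(z)\varphi\,dz$ be the time-frequency localization operator. Let $\alpha_1\ge\alpha_2\ge\cdots>0$ be an enumeration of its positive eigenvalues, repeated according to multiplicity, let $\psi_1,\psi_2,\dots$ be corresponding orthonormal eigenfunctions, and let $V_N=\operatorname{span}\{\psi_1,\dots,\psi_N\}$. A function $f\in L^2(\mathbb R)$ is $(\varepsilon,\varphi)$-concentrated in $\Omega$ if $\langle H_{\Omega,\varphi}f,f\rangle\ge(1-\varepsilon)\|f\|_2^2$. Feichtinger's algebra $S_0(\mathbb R)$ consists of the $f\in L^2(\mathbb R)$ with $V_{\varphi_0}f\in L^1(\mathbb R^2)$, where $\varphi_0(t)=e^{-\pi t^2}$.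 The covering index of a finite set $\Lambda\subset\mathbb R^2$ is $N_0(\Lambda)=\sup_{m\in\mathbb Z^2}\#(\Lambda\cap Q_1(m))$, where $Q_1(m)$ is the closed unit square centred at $m$. A number $B$ is called a Bessel bound for $\Lambda$ if $\sum_{\lambda\in\Lambda}|V_\varphi f(\lambda)|^2\le B\|f\|_2^2$ for all $f\in L^2(\mathbb R)$. **Lemma (approximate reconstruction).** Let $\varphi\in S_0(\mathbb R)$ with $\|\varphi\|_2=1$. There is a constant $C_\varphi>0$, depending only on $\varphi$, such that for every compact $\Omega\subset\mathbb R^2$ and every finite subset $\Lambda=\{\lambda_j\}_{j=1}^r$ of $\Omega$ the number $C_\varphi N_0(\Lambda)$ is a Bessel bound for $\Lambda$, and the following holds for $B=C_\varphi N_0(\Lambda)$ and, more generally, for every Bessel bound $B$ for $\Lambda$. Let $N\ge 1$, let $\alpha_N\ge\gamma\ge\alpha_{N+1}$ with $\gamma<1$, let $\varepsilon\in\mathbb R$, and let $f$ be $(\varepsilon,\varphi)$-concentrated in $\Omega$. Then the least squares problem $$p_{\mathrm{opt}}=\operatorname*{arg\,min}_{p\in V_N}\sum_{j=1}^r|V_\varphi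 f(\lambda_j)-V_\varphi p(\lambda_j)|^2$$ has a solution, and every solution satisfies $$\sum_{j=1}^r|V_\varphi f(\lambda_j)-V_\varphi p_{\mathrm{opt}}(\lambda_j)|^2\le B\,\frac{\varepsilon}{1-\gamma}\,\|f\|_2^2 .$$ -/

import Mathlib

open MeasureTheory
open scoped ENNReal

noncomputable section

namespace TFSampling

/-- The Hilbert space `L²(ℝ)` of complex-valued functions. Points `z = (x, ω)` of the
time-frequency plane are elements of `ℝ × ℝ`. -/
abbrev L2R : Type := Lp ℂ 2 (volume : Measure ℝ)

/-- The short-time Fourier transform of `f` with window `φ`,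
`V_φ f (x, ω) = ∫ f(t) conj(φ(t - x)) e^{-2πiωt} dt`. -/
def stft (φ f : ℝ → ℂ) (z : ℝ × ℝ) : ℂ :=
  ∫ t : ℝ, f t * (starRingEnd ℂ) (φ (t - z.1)) *
    Complex.exp (-(2 * Real.pi * z.2 * t : ℝ) * Complex.I)

lemma memLp_tfShift (z : ℝ × ℝ) (g : L2R) :
    MemLp (fun t : ℝ => g (t - z.1) * Complex.exp ((2 * Real.pi * z.2 * t : ℝ) * Complex.I))
      2 (volume : Measure ℝ) := by
  have h1 : MemLp (fun t : ℝ => g (t - z.1)) 2 (volume : Measure ℝ) :=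
    (Lp.memLp g).comp_measurePreserving (measurePreserving_sub_right volume z.1)
  refine h1.congr_norm (h1.aestronglyMeasurable.mul ?_) (Filter.Eventually.of_forall fun t => ?_)
  · exact Continuous.aestronglyMeasurable (by fun_prop)
  · rw [norm_mul, Complex.norm_exp_ofReal_mul_I, mul_one]

/-- The time-frequency shift `(π(z) g)(t) = g(t - x) e^{2πiωt}`, `z = (x, ω)`, on `L²(ℝ)`. -/
def tfShift (z : ℝ × ℝ) (g : L2R) : L2R := (memLp_tfShift z g).toLp

/-- The Gaussian `φ₀(t) = e^{-πt²}`. -/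
def gaussianWindow (t : ℝ) : ℂ := (Real.exp (-Real.pi * t ^ 2) : ℝ)

/-- Membership in Feichtinger's algebra `S₀(ℝ)`: the STFT with Gaussian window is in `L¹(ℝ²)`. -/
def MemFeichtinger (f : L2R) : Prop :=
  Integrable (stft gaussianWindow f) (volume : Measure (ℝ × ℝ))

/-- The time-frequency localization operator `H_{Ω,φ} f = ∬_Ω V_φ f(z) π(z)φ dz`.
For compact `Ω` the integrand is a continuous `L²(ℝ)`-valued function of `z`, so this Bochner
integral exists and agrees with the weak one. -/
def locOp (Ω : Set (ℝ × ℝ)) (φ f : L2R) : L2R :=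
  ∫ z in Ω, stft φ f z • tfShift z φ

/-- `f` is `(ε, φ)`-concentrated in `Ω`: `⟨H_{Ω,φ} f, f⟩ ≥ (1 - ε) ‖f‖²`. (Mathlib's inner product
is linear in the second slot, and the quantity is real.) -/
def IsConcentrated (ε : ℝ) (φ : L2R) (Ω : Set (ℝ × ℝ)) (f : L2R) : Prop :=
  (1 - ε) * ‖f‖ ^ 2 ≤ (inner ℂ f (locOp Ω φ f)).re

/-- `α 0 ≥ α 1 ≥ ⋯ > 0` is the list of all positive eigenvalues of `H_{Ω,φ}`, repeated according
to multiplicity, and `ψ 0, ψ 1, …` are corresponding orthonormal eigenfunctions. The indices are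
those of the literature lowered by one: `α k` is the `(k+1)`-st largest eigenvalue. -/
structure IsEigenEnumeration (Ω : Set (ℝ × ℝ)) (φ : L2R) (α : ℕ → ℝ) (ψ : ℕ → L2R) : Prop where
  orthonormal : Orthonormal ℂ ψ
  pos : ∀ k, 0 < α k
  antitone : Antitone α
  eigen : ∀ k, locOp Ω φ (ψ k) = (α k : ℂ) • ψ k
  /-- No eigenfunction with positive eigenvalue is missing from the list. -/
  exhaustive : ∀ (μ : ℝ) (g : L2R), 0 < μ → locOp Ω φ g = (μ : ℂ) • g →
    (∀ k, inner ℂ (ψ k) g = 0) → g = 0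

/-- `V_N`, the span of the eigenfunctions of the `N` largest eigenvalues. -/
def eigenSpan (ψ : ℕ → L2R) (N : ℕ) : Submodule ℂ L2R :=
  Submodule.span ℂ (ψ '' Set.Iio N)

/-- The closed unit square `Q₁(m)` centred at `m ∈ ℤ²`. -/
def unitSquare (m : ℤ × ℤ) : Set (ℝ × ℝ) :=
  Set.Icc ((m.1 : ℝ) - 1 / 2) (m.1 + 1 / 2) ×ˢ Set.Icc ((m.2 : ℝ) - 1 / 2) (m.2 + 1 / 2)

/-- The covering index `N₀(Λ) = sup_{m ∈ ℤ²} #(Λ ∩ Q₁(m))` of a finite set `Λ`. -/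
def coveringIndex (Λ : Finset (ℝ × ℝ)) : ℕ :=
  ⨆ m : ℤ × ℤ, ((Λ : Set (ℝ × ℝ)) ∩ unitSquare m).ncard

/-- `B` is an upper sampling (Bessel) bound of the STFT on `Λ`:
`∑_{λ ∈ Λ} |V_φ f(λ)|² ≤ B ‖f‖²` for all `f ∈ L²(ℝ)`. -/
def IsBesselBound (φ : L2R) (Λ : Finset (ℝ × ℝ)) (B : ℝ) : Prop :=
  ∀ f : L2R, ∑ z ∈ Λ, ‖stft φ f z‖ ^ 2 ≤ B * ‖f‖ ^ 2

/-- The sum of squares `∑_{λ ∈ Λ} |V_φ f(λ) - V_φ p(λ)|²`. -/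
def sampleResidual (φ : L2R) (Λ : Finset (ℝ × ℝ)) (f p : L2R) : ℝ :=
  ∑ z ∈ Λ, ‖stft φ f z - stft φ p z‖ ^ 2

/-- `p` solves the least squares problem of minimizing `sampleResidual φ Λ f` over `V`. -/
def IsLeastSquaresSolution (φ : L2R) (Λ : Finset (ℝ × ℝ)) (V : Submodule ℂ L2R)
    (f p : L2R) : Prop :=
  p ∈ V ∧ ∀ q ∈ V, sampleResidual φ Λ f p ≤ sampleResidual φ Λ f q

end TFSampling

end

open TFSampling

/-! Compare `p_opt` with the orthogonal projection `q` of `f` onto `V_N`: minimality and the Bessel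
bound give a residual of at most `B‖f - q‖²`. It remains to show `(1 - γ)‖f - q‖² ≤ ε‖f‖²`
(`exists_mem_eigenSpan_norm_sub_sq_le`). As `V_N` is invariant under the symmetric operator `H`,
`⟨Hf, f⟩` splits without cross terms over `q` and `g = f - q`. Moyal's identity gives `⟨Hq, q⟩ ≤
‖q‖²`, compactness and completeness of the eigenvalue list give `⟨Hg, g⟩ ≤ α_{N+1}‖g‖²`
(`re_inner_le_of_orthogonal`), and concentration bounds the sum from below.

The Bessel bound `C N₀(Λ)` is proved for the Gaussian window by Schur's test, as its Gram matrix has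
Gaussian decay. For a general window, `|V_φ f|` is dominated by an average of translates of `|V_{φ₀}
f|` with the integrable weight `|V_{φ₀} φ|`, and Cauchy–Schwarz transfers the bound
(`exists_isBesselBound_coveringIndex`). -/

namespace TFSampling

open scoped FourierTransform SchwartzMap

/-! ### Plancherel on `L¹ ∩ L²` -/

/-- The `L²` Fourier transform of a function in `L¹ ∩ L²` is its Fourier integral. -/
lemma fourier_toLp_ae_eq {h : ℝ → ℂ} (h2 : MemLp h 2) (h1 : Integrable h) :
    (𝓕 (h2.toLp h) : L2R) =ᵐ[volume] 𝓕 h := by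
  refine ae_eq_of_integral_contDiff_smul_eq ((Lp.memLp _).locallyIntegrable one_le_two) ?_ ?_
  · exact (VectorFourier.fourierIntegral_continuous Real.continuous_fourierChar
      (by fun_prop) h1).locallyIntegrable
  · intro g hg hgc
    have hg₁ : HasCompactSupport (Complex.ofRealCLM ∘ g) := hgc.comp_left rfl
    have hg₂ : ContDiff ℝ (⊤ : ℕ∞) (Complex.ofRealCLM ∘ g) :=
      Complex.ofRealCLM.contDiff.comp hg
    set G : 𝓢(ℝ, ℂ) := hg₁.toSchwartzMap hg₂ with hG
    have hGg : ∀ x, G x = (g x : ℂ) := fun x => by simp [hG]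
    -- Both transforms move onto the test function: the `L²` one by distributional duality (`key`),
    -- the integral one by Fubini (`hflip`).
    have key := congrArg (fun T : 𝓢'(ℝ, ℂ) => T G)
      (Lp.fourier_toTemperedDistribution_eq (h2.toLp h))
    simp only [TemperedDistribution.fourier_apply, Lp.toTemperedDistribution_apply] at key
    have hflip := VectorFourier.integral_fourierIntegral_smul_eq_flip
      (L := innerₗ ℝ) (μ := (volume : Measure ℝ)) (ν := (volume : Measure ℝ))
      (f := G) (g := h) Real.continuous_fourierChar (by fun_prop) G.integrable h1
    calc ∫ x, g x • (𝓕 (h2.toLp h) : L2R) x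
        = ∫ x, G x • (𝓕 (h2.toLp h) : L2R) x := by simp [hGg]
      _ = ∫ x, (𝓕 G) x • (h2.toLp h) x := key.symm
      _ = ∫ x, (𝓕 G) x • h x := by
        refine integral_congr_ae ?_
        filter_upwards [h2.coeFn_toLp] with x hx
        rw [hx]
      _ = ∫ x, G x • 𝓕 h x := by
        rw [flip_innerₗ] at hflip
        exact hflip
      _ = ∫ x, g x • 𝓕 h x := by simp [hGg]

lemma enorm_sq_toLp {h : ℝ → ℂ} (h2 : MemLp h 2) :
    ‖h2.toLp h‖ₑ ^ 2 = ∫⁻ t, ‖h t‖ₑ ^ 2 := by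
  rw [Lp.enorm_toLp, eLpNorm_eq_lintegral_rpow_enorm_toReal two_ne_zero ENNReal.ofNat_ne_top]
  simp only [ENNReal.toReal_ofNat, ENNReal.rpow_ofNat]
  rw [← ENNReal.rpow_natCast, ← ENNReal.rpow_mul]
  norm_num

lemma enorm_sq_eq_lintegral (f : L2R) : ‖f‖ₑ ^ 2 = ∫⁻ t, ‖f t‖ₑ ^ 2 := by
  rw [← enorm_sq_toLp (Lp.memLp f), Lp.toLp_coeFn]

/-- Plancherel's theorem for functions in `L¹ ∩ L²`. -/
lemma lintegral_fourier_sq {h : ℝ → ℂ} (h2 : MemLp h 2) (h1 : Integrable h) :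
    ∫⁻ ω, ‖𝓕 h ω‖ₑ ^ 2 = ∫⁻ t, ‖h t‖ₑ ^ 2 := by
  rw [← enorm_sq_toLp h2]
  have : ‖h2.toLp h‖ₑ = ‖(𝓕 (h2.toLp h) : L2R)‖ₑ := by
    rw [← ofReal_norm, ← ofReal_norm, Lp.norm_fourier_eq]
  rw [this, enorm_sq_eq_lintegral]
  refine lintegral_congr_ae ?_
  filter_upwards [fourier_toLp_ae_eq h2 h1] with x hx
  rw [hx]

/-! ### Time-frequency shifts and their strong continuity -/

lemma tfShift_coeFn (z : ℝ × ℝ) (g : L2R) :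
    tfShift z g =ᵐ[volume]
      fun t : ℝ => g (t - z.1) * Complex.exp ((2 * Real.pi * z.2 * t : ℝ) * Complex.I) :=
  (memLp_tfShift z g).coeFn_toLp

lemma conj_exp_ofReal_mul_I (s : ℝ) :
    (starRingEnd ℂ) (Complex.exp (s * Complex.I)) = Complex.exp (-(s : ℂ) * Complex.I) := by
  rw [← Complex.exp_conj]; simp

lemma stft_eq_inner (φ f : L2R) (z : ℝ × ℝ) : stft φ f z = inner ℂ (tfShift z φ) f := by
  rw [L2.inner_def, stft]
  refine integral_congr_ae ?_
  filter_upwards [tfShift_coeFn z φ] with t ht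
  rw [ht, RCLike.inner_apply, map_mul, conj_exp_ofReal_mul_I, mul_assoc]

lemma norm_tfShift (z : ℝ × ℝ) (g : L2R) : ‖tfShift z g‖ = ‖g‖ := by
  have h : ‖tfShift z g‖ₑ ^ 2 = ‖g‖ₑ ^ 2 := by
    rw [tfShift, enorm_sq_toLp, enorm_sq_eq_lintegral,
      ← lintegral_sub_right_eq_self (fun t => ‖g t‖ₑ ^ 2) z.1]
    refine lintegral_congr fun t => ?_
    rw [← ofReal_norm, norm_mul, Complex.norm_exp_ofReal_mul_I, mul_one,
      ofReal_norm]
  have h' := congrArg ENNReal.toReal h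
  simp only [ENNReal.toReal_pow, toReal_enorm] at h'
  exact (pow_left_inj₀ (norm_nonneg _) (norm_nonneg _) two_ne_zero).1 h'

lemma stft_add (φ f g : L2R) (z : ℝ × ℝ) : stft φ (f + g : L2R) z = stft φ f z + stft φ g z := by
  simp only [stft_eq_inner, inner_add_right]

lemma stft_sub (φ f g : L2R) (z : ℝ × ℝ) : stft φ (f - g : L2R) z = stft φ f z - stft φ g z := by
  simp only [stft_eq_inner, inner_sub_right]

lemma stft_smul (φ f : L2R) (c : ℂ) (z : ℝ × ℝ) : stft φ (c • f : L2R) z = c * stft φ f z := by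
  simp only [stft_eq_inner, inner_smul_right]

lemma norm_stft_le (φ f : L2R) (z : ℝ × ℝ) : ‖stft φ f z‖ ≤ ‖φ‖ * ‖f‖ := by
  rw [stft_eq_inner, ← norm_tfShift z φ]
  exact norm_inner_le_norm _ _

/-- Translation is strongly continuous on `L²(ℝ)`. -/
lemma continuous_tfShift_fst (g : L2R) : Continuous fun x : ℝ => tfShift (x, 0) g := by
  have h := Continuous.compMeasurePreservingLp (μ := (volume : Measure ℝ)) (p := 2)
    (f := fun _ : ℝ => g) (g := fun x : ℝ => (⟨fun t => t - x, by fun_prop⟩ : C(ℝ, ℝ)))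
    continuous_const
    (ContinuousMap.continuous_of_continuous_uncurry _ (by
      simp only [Function.uncurry_def, ContinuousMap.coe_mk]; fun_prop))
    (fun x => measurePreserving_sub_right volume x) ENNReal.ofNat_ne_top
  convert h using 2 with x
  refine Lp.ext ?_
  filter_upwards [tfShift_coeFn (x, 0) g, Lp.coeFn_compMeasurePreserving g
    (measurePreserving_sub_right volume x)] with t h1 h2
  rw [h1]
  refine Eq.trans ?_ h2.symm
  simp

lemma tfShift_sub (z : ℝ × ℝ) (f g : L2R) : tfShift z (f - g) = tfShift z f - tfShift z g := by
  refine Lp.ext ?_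
  have h := (measurePreserving_sub_right (volume : Measure ℝ) z.1).quasiMeasurePreserving.ae
    (Lp.coeFn_sub f g)
  filter_upwards [tfShift_coeFn z (f - g), tfShift_coeFn z f, tfShift_coeFn z g,
    Lp.coeFn_sub (tfShift z f) (tfShift z g), h] with t h1 h2 h3 h4 h5
  rw [h1, h4, Pi.sub_apply, h2, h3, h5, Pi.sub_apply, sub_mul]

lemma tfShift_modulation (x ω : ℝ) (g : L2R) :
    tfShift (x, ω) g = tfShift (0, ω) (tfShift (x, 0) g) := by
  refine Lp.ext ?_
  filter_upwards [tfShift_coeFn (x, ω) g, tfShift_coeFn (0, ω) (tfShift (x, 0) g),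
    tfShift_coeFn (x, 0) g] with t h1 h2 h3
  rw [h1, h2]
  simp only [sub_zero]
  rw [h3]
  simp

/-- Modulation is strongly continuous on `L²(ℝ)`. -/
lemma continuous_tfShift_snd (g : L2R) : Continuous fun ω : ℝ => tfShift (0, ω) g := by
  refine continuous_iff_continuousAt.2 fun ω₀ => ?_
  rw [ContinuousAt, tendsto_iff_norm_sub_tendsto_zero]
  have hnorm : ∀ f : L2R, ‖f‖ ^ 2 = ∫ t, ‖f t‖ ^ 2 := fun f => by
    rw [← inner_self_eq_norm_sq (𝕜 := ℂ), L2.inner_def, ← integral_re (L2.integrable_inner f f)]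
    simp only [inner_self_eq_norm_sq]
  have hint : ∀ f : L2R, Integrable (fun t => ‖f t‖ ^ 2) := fun f =>
    (memLp_two_iff_integrable_sq_norm (Lp.memLp f).1).1 (Lp.memLp f)
  set E : ℝ → ℝ → ℂ := fun ω t => Complex.exp ((2 * Real.pi * ω * t : ℝ) * Complex.I) with hE
  have hsq : ∀ ω, ‖tfShift (0, ω) g - tfShift (0, ω₀) g‖ ^ 2 =
      ∫ t, ‖E ω t - E ω₀ t‖ ^ 2 * ‖g t‖ ^ 2 := by
    intro ω
    rw [hnorm]
    refine integral_congr_ae ?_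
    filter_upwards [tfShift_coeFn (0, ω) g, tfShift_coeFn (0, ω₀) g,
      Lp.coeFn_sub (tfShift (0, ω) g) (tfShift (0, ω₀) g)] with t h1 h2 h3
    rw [h3, Pi.sub_apply, h1, h2]
    simp only [sub_zero]
    rw [← mul_sub, norm_mul, mul_pow, mul_comm]
  have hlim : Filter.Tendsto (fun ω => ∫ t, ‖E ω t - E ω₀ t‖ ^ 2 * ‖g t‖ ^ 2) (nhds ω₀)
      (nhds (∫ t, ‖E ω₀ t - E ω₀ t‖ ^ 2 * ‖g t‖ ^ 2)) := by
    refine tendsto_integral_filter_of_dominated_convergence (fun t => 4 * ‖g t‖ ^ 2)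
      (Filter.Eventually.of_forall fun ω => ?_) (Filter.Eventually.of_forall fun ω =>
        Filter.Eventually.of_forall fun t => ?_) ((hint g).const_mul 4)
      (Filter.Eventually.of_forall fun t => ?_)
    · refine AEStronglyMeasurable.mul (Continuous.aestronglyMeasurable ?_) (hint g).1
      simp only [hE]; fun_prop
    · rw [Real.norm_of_nonneg (by positivity)]
      have h1 : ‖E ω t - E ω₀ t‖ ≤ 2 := by
        refine (norm_sub_le _ _).trans ?_
        simp only [hE, Complex.norm_exp_ofReal_mul_I]; norm_num
      gcongr
      nlinarith [norm_nonneg (E ω t - E ω₀ t)]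
    · refine Continuous.tendsto (f := fun ω => ‖E ω t - E ω₀ t‖ ^ 2 * ‖g t‖ ^ 2) ?_ ω₀
      simp only [hE]; fun_prop
  simp only [sub_self, norm_zero, ne_eq, OfNat.ofNat_ne_zero, not_false_eq_true, zero_pow,
    zero_mul, integral_zero, ← hsq] at hlim
  have h2 := (Real.continuous_sqrt.tendsto 0).comp hlim
  simpa [Function.comp_def, Real.sqrt_sq] using h2

/-- The time-frequency shifts are strongly continuous on `L²(ℝ)`. -/
lemma continuous_tfShift (g : L2R) : Continuous fun z : ℝ × ℝ => tfShift z g := by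
  refine continuous_iff_continuousAt.2 fun z₀ => ?_
  rw [ContinuousAt, tendsto_iff_norm_sub_tendsto_zero]
  have h1 : Continuous fun z : ℝ × ℝ =>
      ‖tfShift (z.1, 0) g - tfShift (z₀.1, 0) g‖ +
        ‖tfShift (0, z.2) (tfShift (z₀.1, 0) g) - tfShift (0, z₀.2) (tfShift (z₀.1, 0) g)‖ :=
    ((((continuous_tfShift_fst g).comp continuous_fst).sub continuous_const).norm).add
      ((((continuous_tfShift_snd _).comp continuous_snd).sub continuous_const).norm)
  have h2 := h1.tendsto z₀
  simp only [sub_self, norm_zero, add_zero] at h2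
  refine squeeze_zero (fun _ => norm_nonneg _) (fun z => ?_) h2
  -- The intermediate point is modulation by `z.2` of the translate by `z₀.1`; modulation is
  -- isometric, so the first difference does not depend on the frequency.
  rw [show tfShift z g = _ from tfShift_modulation z.1 z.2 g,
    show tfShift z₀ g = _ from tfShift_modulation z₀.1 z₀.2 g,
    ← norm_tfShift (0, z.2) (tfShift (z.1, 0) g - _), tfShift_sub]
  exact norm_sub_le_norm_sub_add_norm_sub _ _ _

lemma continuous_stft (φ f : L2R) : Continuous (stft φ f) := by
  have : stft φ f = fun z => inner ℂ (tfShift z φ) f := funext (stft_eq_inner φ f)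
  rw [this]
  exact (continuous_tfShift φ).inner continuous_const

/-! ### Moyal's identity -/

/-- Moyal's identity in `ℝ≥0∞`. -/
lemma lintegral_stft_sq (φ f : L2R) :
    ∫⁻ z, ‖stft φ f z‖ₑ ^ 2 = ‖f‖ₑ ^ 2 * ‖φ‖ₑ ^ 2 := by
  -- For fixed `x`, the function `ω ↦ V_φ f(x, ω)` is the Fourier transform of `h x`, so Plancherel
  -- applies in `ω` for almost every `x`.
  set h : ℝ → ℝ → ℂ := fun x t => f t * (starRingEnd ℂ) (φ (t - x)) with hh
  have hf : Measurable f := (Lp.stronglyMeasurable f).measurable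
  have hφ : Measurable φ := (Lp.stronglyMeasurable φ).measurable
  have hm : Measurable fun p : ℝ × ℝ => ‖h p.1 p.2‖ₑ ^ 2 := by
    simp only [hh]
    exact ((hf.comp measurable_snd).mul (Complex.continuous_conj.measurable.comp
      (hφ.comp (measurable_snd.sub measurable_fst)))).enorm.pow_const 2
  have htot : ∫⁻ x, ∫⁻ t, ‖h x t‖ₑ ^ 2 = ‖f‖ₑ ^ 2 * ‖φ‖ₑ ^ 2 := by
    rw [lintegral_lintegral_swap hm.aemeasurable]
    have : ∀ t, ∫⁻ x, ‖h x t‖ₑ ^ 2 = ‖f t‖ₑ ^ 2 * ‖φ‖ₑ ^ 2 := by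
      intro t
      have h1 : ∀ x, ‖h x t‖ₑ ^ 2 = ‖f t‖ₑ ^ 2 * ‖φ (t - x)‖ₑ ^ 2 := fun x => by
        simp only [hh]
        rw [enorm_mul, mul_pow, ← ofReal_norm (starRingEnd ℂ _), RCLike.norm_conj,
          ofReal_norm]
      simp only [h1]
      rw [lintegral_const_mul _ ((show Measurable fun x => ‖φ (t - x)‖ₑ ^ 2 from
        (hφ.comp (measurable_id.const_sub t)).enorm.pow_const 2)),
        enorm_sq_eq_lintegral, lintegral_sub_left_eq_self (fun s => ‖φ s‖ₑ ^ 2) t]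
    simp only [this]
    rw [lintegral_mul_const _ (hf.enorm.pow_const 2), ← enorm_sq_eq_lintegral]
  have hfin : ∀ᵐ x, ∫⁻ t, ‖h x t‖ₑ ^ 2 < ∞ := by
    refine ae_lt_top (Measurable.lintegral_prod_right' hm) ?_
    rw [htot]
    exact ENNReal.mul_ne_top (by simp) (by simp)
  rw [← htot, Measure.volume_eq_prod,
    lintegral_prod _ ((continuous_stft φ f).measurable.enorm.pow_const 2).aemeasurable]
  refine lintegral_congr_ae ?_
  filter_upwards [hfin] with x hx
  have hx1 : AEStronglyMeasurable (h x) volume := by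
    simp only [hh]
    exact (hf.mul (Complex.continuous_conj.measurable.comp
      (hφ.comp (measurable_id.sub measurable_const)))).aestronglyMeasurable
  have hx2 : MemLp (h x) 2 := by
    refine ⟨hx1, ?_⟩
    rw [eLpNorm_lt_top_iff_lintegral_rpow_enorm_lt_top two_ne_zero ENNReal.ofNat_ne_top]
    simpa using hx
  have hx3 : Integrable (h x) := by
    have hφx : MemLp (fun t => (starRingEnd ℂ) (φ (t - x))) 2 volume :=
      ((Lp.memLp φ).comp_measurePreserving (measurePreserving_sub_right volume x)).star
    exact (Lp.memLp f).integrable_mul hφx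
  rw [← lintegral_fourier_sq hx2 hx3]
  refine lintegral_congr fun ω => ?_
  rw [Real.fourier_real_eq_integral_exp_smul]
  congr 2
  rw [stft]
  refine integral_congr_ae (Filter.Eventually.of_forall fun t => ?_)
  simp only [hh, smul_eq_mul]
  rw [mul_comm]
  congr 2
  push_cast; ring

lemma integrable_stft_sq (φ f : L2R) : Integrable fun z => ‖stft φ f z‖ ^ 2 := by
  refine ⟨((continuous_stft φ f).norm.pow 2).aestronglyMeasurable, ?_⟩
  rw [hasFiniteIntegral_iff_enorm]
  have : ∀ z, ‖‖stft φ f z‖ ^ 2‖ₑ = ‖stft φ f z‖ₑ ^ 2 := fun z => by simp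
  simp only [this, lintegral_stft_sq]
  exact ENNReal.mul_lt_top (by simp) (by simp)

/-- Moyal's identity. -/
lemma integral_stft_sq (φ f : L2R) : ∫ z, ‖stft φ f z‖ ^ 2 = ‖f‖ ^ 2 * ‖φ‖ ^ 2 := by
  rw [integral_eq_lintegral_of_nonneg_ae (Filter.Eventually.of_forall fun z => by positivity)
    (integrable_stft_sq φ f).1]
  have : ∀ z, ENNReal.ofReal (‖stft φ f z‖ ^ 2) = ‖stft φ f z‖ₑ ^ 2 := fun z => by
    rw [ENNReal.ofReal_pow (norm_nonneg _), ofReal_norm]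
  simp only [this, lintegral_stft_sq]
  simp

/-! ### The localization operator is compact, symmetric and between 0 and 1 -/

lemma rankOne_mem_compactOperator (x : L2R) :
    InnerProductSpace.rankOne ℂ x x ∈ compactOperator (RingHom.id ℂ) L2R L2R := by
  have h : IsCompactOperator (innerSL ℂ x : L2R →L[ℂ] ℂ) :=
    isCompactOperator_of_locallyCompactSpace_dom _
  have h' := h.clm_comp (ContinuousLinearMap.toSpanSingleton ℂ x)
  exact h'

/-- The localization operator as the Bochner integral of rank-one operators. -/
noncomputable def locOpCLM (Ω : Set (ℝ × ℝ)) (φ : L2R) : L2R →L[ℂ] L2R :=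
  ∫ z in Ω, InnerProductSpace.rankOne ℂ (tfShift z φ) (tfShift z φ)

lemma continuous_rankOne_tfShift (φ : L2R) :
    Continuous fun z => InnerProductSpace.rankOne ℂ (tfShift z φ) (tfShift z φ) :=
  (ContinuousLinearMap.smulRightL ℂ L2R L2R).continuous₂.comp
    (((innerSL ℂ).continuous.comp (continuous_tfShift φ)).prodMk (continuous_tfShift φ))

variable {Ω : Set (ℝ × ℝ)}

lemma locOpCLM_apply (hΩ : IsCompact Ω) (φ f : L2R) : locOpCLM Ω φ f = locOp Ω φ f := by
  rw [locOpCLM, ContinuousLinearMap.integral_apply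
    ((continuous_rankOne_tfShift φ).continuousOn.integrableOn_compact hΩ), locOp]
  simp only [InnerProductSpace.rankOne_apply, stft_eq_inner]

/-- The integrand is norm continuous with values in the closed subspace of compact operators, so the
integral can be taken inside that subspace. -/
lemma isCompactOperator_locOpCLM (hΩ : IsCompact Ω) (φ : L2R) :
    IsCompactOperator (locOpCLM Ω φ) := by
  let K := compactOperator (RingHom.id ℂ) L2R L2R
  have hK : IsClosed (K : Set (L2R →L[ℂ] L2R)) := isClosed_setOfPred_isCompactOperator
  have : CompleteSpace K := hK.completeSpace_coe
  let R : ℝ × ℝ → K := fun z => ⟨_, rankOne_mem_compactOperator (tfShift z φ)⟩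
  have hR : Continuous R := (continuous_rankOne_tfShift φ).subtype_mk _
  have h := ContinuousLinearMap.integral_comp_comm (𝕜 := ℂ) K.subtypeL
    (hR.continuousOn.integrableOn_compact (μ := volume) hΩ)
  have h' : locOpCLM Ω φ = ((∫ z in Ω, R z : K) : L2R →L[ℂ] L2R) := h
  rw [h']
  exact (∫ z in Ω, R z : K).2

lemma inner_locOpCLM (hΩ : IsCompact Ω) (φ f g : L2R) :
    inner ℂ g (locOpCLM Ω φ f) = ∫ z in Ω, stft φ f z * (starRingEnd ℂ) (stft φ g z) := by
  rw [locOpCLM_apply hΩ, locOp, ← integral_inner]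
  · refine integral_congr_ae (Filter.Eventually.of_forall fun z => ?_)
    simp only [inner_smul_right, stft_eq_inner φ g, inner_conj_symm]
  · exact (((continuous_stft φ f).smul (continuous_tfShift φ)).continuousOn).integrableOn_compact hΩ

lemma inner_self_locOpCLM (hΩ : IsCompact Ω) (φ f : L2R) :
    inner ℂ f (locOpCLM Ω φ f) = ((∫ z in Ω, ‖stft φ f z‖ ^ 2 : ℝ) : ℂ) := by
  rw [inner_locOpCLM hΩ, ← integral_complex_ofReal]
  simp [Complex.mul_conj']

lemma isSymmetric_locOpCLM (hΩ : IsCompact Ω) (φ : L2R) :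
    (locOpCLM Ω φ : L2R →ₗ[ℂ] L2R).IsSymmetric := by
  intro f g
  simp only [ContinuousLinearMap.coe_coe]
  rw [← inner_conj_symm, inner_locOpCLM hΩ, inner_locOpCLM hΩ, ← integral_conj]
  simp [mul_comm]

lemma re_inner_locOpCLM_nonneg (hΩ : IsCompact Ω) (φ f : L2R) :
    0 ≤ (inner ℂ f (locOpCLM Ω φ f)).re := by
  rw [inner_self_locOpCLM hΩ, Complex.ofReal_re]
  positivity

lemma re_inner_locOpCLM_le (hΩ : IsCompact Ω) (φ f : L2R) :
    (inner ℂ f (locOpCLM Ω φ f)).re ≤ ‖f‖ ^ 2 * ‖φ‖ ^ 2 := by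
  rw [inner_self_locOpCLM hΩ, Complex.ofReal_re, ← integral_stft_sq]
  exact setIntegral_le_integral (integrable_stft_sq φ f)
    (Filter.Eventually.of_forall fun z => by positivity)

/-! ### Spectral bound on the complement of the leading eigenvectors -/

section Spectral

variable {E : Type*} [NormedAddCommGroup E] [InnerProductSpace ℂ E] [CompleteSpace E]

/-- If all eigenvalues of a compact symmetric operator have absolute value at most `a`, then so has
its norm. -/
lemma norm_le_of_eigenvalue_le {S : E →L[ℂ] E} (hc : IsCompactOperator S)
    (hs : (S : E →ₗ[ℂ] E).IsSymmetric) {a : ℝ} (ha : 0 ≤ a)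
    (h : ∀ (μ : ℝ) (v : E), v ≠ 0 → S v = (μ : ℂ) • v → |μ| ≤ a) : ‖S‖ ≤ a := by
  -- For a self-adjoint operator the norm is the spectral radius, and nonzero spectrum of a compact
  -- operator consists of eigenvalues.
  have hle : spectralRadius ℂ S ≤ ENNReal.ofReal a := by
    refine iSup₂_le fun k hk => ?_
    by_cases hk0 : k = 0
    · simp [hk0]
    have hev := (hc.hasEigenvalue_iff_mem_spectrum hk0).2 hk
    obtain ⟨v, hv⟩ := hev.exists_hasEigenvector
    have hreal : ((k.re : ℝ) : ℂ) = k := Complex.conj_eq_iff_re.1 (hs.conj_eigenvalue_eq_self hev)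
    have h1 := h k.re v hv.2 (by rw [hreal]; exact hv.apply_eq_smul)
    rw [← hreal, ← enorm_eq_nnnorm, ← ofReal_norm, Complex.norm_real]
    exact ENNReal.ofReal_le_ofReal h1
  rw [S.spectralRadius_eq_nnnorm hs.isSelfAdjoint, ← enorm_eq_nnnorm, ← ofReal_norm] at hle
  exact (ENNReal.ofReal_le_ofReal_iff ha).1 hle

/-- Courant–Fischer upper bound: a complete list of eigenvectors of a compact positive operator,
ordered by decreasing eigenvalue, controls the quadratic form on the orthogonal complement of the
first `N` eigenvectors. -/
lemma re_inner_le_of_orthogonal {H : E →L[ℂ] E} (hc : IsCompactOperator H)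
    (hs : (H : E →ₗ[ℂ] E).IsSymmetric) (hpos : ∀ f, 0 ≤ (inner ℂ f (H f)).re)
    {α : ℕ → ℝ} {ψ : ℕ → E} (hα : ∀ k, 0 < α k) (hanti : Antitone α)
    (heig : ∀ k, H (ψ k) = (α k : ℂ) • ψ k)
    (hex : ∀ (μ : ℝ) (g : E), 0 < μ → H g = (μ : ℂ) • g → (∀ k, inner ℂ (ψ k) g = 0) → g = 0)
    (N : ℕ) {g : E} (hg : ∀ k < N, inner ℂ (ψ k) g = 0) :
    (inner ℂ g (H g)).re ≤ α N * ‖g‖ ^ 2 := by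
  let W : Submodule ℂ E := (Submodule.span ℂ (ψ '' Set.Iio N))ᗮ
  have hmem : ∀ v, v ∈ W ↔ ∀ k < N, inner ℂ (ψ k) v = 0 := by
    intro v
    rw [Submodule.mem_orthogonal]
    refine ⟨fun h k hk => h _ (Submodule.subset_span ⟨k, hk, rfl⟩), fun h u hu => ?_⟩
    induction hu using Submodule.span_induction with
    | mem x hx => obtain ⟨k, hk, rfl⟩ := hx; exact h k hk
    | zero => simp
    | add x y _ _ hx hy => rw [inner_add_left, hx, hy, add_zero]
    | smul c x _ hx => rw [inner_smul_left, hx, mul_zero]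
  have hinner : ∀ k v, inner ℂ (ψ k) (H v) = (α k : ℂ) * inner ℂ (ψ k) v := by
    intro k v
    have h1 := hs (ψ k) v
    simp only [ContinuousLinearMap.coe_coe] at h1
    rw [← h1, heig, inner_smul_left, Complex.conj_ofReal]
  have hinv : ∀ v ∈ W, H v ∈ W := by
    intro v hv
    rw [hmem] at hv ⊢
    intro k hk
    rw [hinner, hv k hk, mul_zero]
  let S : W →L[ℂ] W := H.restrict hinv
  have hSc : IsCompactOperator S := hc.restrict' hinv
  have hSs : (S : W →ₗ[ℂ] W).IsSymmetric := hs.restrict_invariant hinv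
  have hnorm : ‖S‖ ≤ α N := by
    refine norm_le_of_eigenvalue_le hSc hSs (hα N).le fun μ v hv hμ => ?_
    have hHv : H v = (μ : ℂ) • (v : E) := congrArg Subtype.val hμ
    have hv0 : (v : E) ≠ 0 := fun h => hv (Subtype.ext h)
    have hvn : 0 < ‖(v : E)‖ ^ 2 := by positivity
    have hμ0 : 0 ≤ μ := by
      have h1 := hpos v
      rw [hHv, inner_smul_right, inner_self_eq_norm_sq_to_K] at h1
      have h2 : ((μ : ℂ) * ((‖(v : E)‖ : ℝ) : ℂ) ^ 2).re = μ * ‖(v : E)‖ ^ 2 := by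
        rw [← Complex.ofReal_pow, ← Complex.ofReal_mul, Complex.ofReal_re]
      exact nonneg_of_mul_nonneg_left (h2 ▸ h1) hvn
    rw [abs_of_nonneg hμ0]
    -- An eigenvector in `W` with `μ > α N` is orthogonal to `ψ k` for `k < N` by membership in `W`,
    -- and for `k ≥ N` because `μ ≠ α k`; completeness of the list kills it.
    by_contra! hlt
    refine hv0 (hex μ v ((hα N).trans hlt) hHv fun k => ?_)
    rcases lt_or_ge k N with hk | hk
    · exact (hmem v).1 v.2 k hk
    · have h1 := hinner k v
      rw [hHv, inner_smul_right] at h1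
      have hne : (μ : ℂ) - α k ≠ 0 := by
        rw [← Complex.ofReal_sub, Complex.ofReal_ne_zero]
        linarith [hanti hk]
      have h2 : ((μ : ℂ) - α k) * inner ℂ (ψ k) (v : E) = 0 := by rw [sub_mul, h1, sub_self]
      exact (mul_eq_zero.1 h2).resolve_left hne
  have hgW : g ∈ W := (hmem g).2 hg
  calc (inner ℂ g (H g)).re ≤ ‖inner ℂ g (H g)‖ := Complex.re_le_norm _
    _ ≤ ‖g‖ * ‖H g‖ := norm_inner_le_norm _ _
    _ ≤ ‖g‖ * (α N * ‖g‖) := by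
      gcongr
      exact S.le_of_opNorm_le hnorm ⟨g, hgW⟩
    _ = α N * ‖g‖ ^ 2 := by ring

end Spectral

/-! ### The Gaussian window and covariance -/

lemma memLp_gaussianWindow : MemLp gaussianWindow 2 (volume : Measure ℝ) := by
  have hc : Continuous gaussianWindow := by unfold gaussianWindow; fun_prop
  rw [memLp_two_iff_integrable_sq_norm hc.aestronglyMeasurable]
  refine (integrable_exp_neg_mul_sq (b := 2 * Real.pi) (by positivity)).congr
    (Filter.Eventually.of_forall fun t => ?_)
  simp only [gaussianWindow, Complex.norm_real, Real.norm_eq_abs, Real.abs_exp]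
  rw [← Real.exp_nat_mul]
  congr 1; push_cast; ring

/-- The Gaussian as an element of `L²(ℝ)`. -/
noncomputable def gaussianL2 : L2R := memLp_gaussianWindow.toLp

lemma stft_congr_left {φ φ' : ℝ → ℂ} (h : φ =ᵐ[volume] φ') (f : ℝ → ℂ) :
    stft φ f = stft φ' f := by
  funext z
  refine integral_congr_ae ?_
  filter_upwards [(measurePreserving_sub_right (volume : Measure ℝ) z.1).quasiMeasurePreserving.ae h]
    with t ht
  rw [ht]

lemma stft_congr_right (φ : ℝ → ℂ) {f f' : ℝ → ℂ} (h : f =ᵐ[volume] f') :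
    stft φ f = stft φ f' := by
  funext z
  refine integral_congr_ae ?_
  filter_upwards [h] with t ht
  rw [ht]

lemma stft_gaussianL2 (f : ℝ → ℂ) : stft gaussianL2 f = stft gaussianWindow f :=
  stft_congr_left memLp_gaussianWindow.coeFn_toLp f

lemma norm_gaussianL2_pos : 0 < ‖gaussianL2‖ := by
  rw [norm_pos_iff]
  intro h
  have h1 : gaussianWindow =ᵐ[volume] (0 : ℝ → ℂ) := by
    have h2 := memLp_gaussianWindow.coeFn_toLp
    rw [show memLp_gaussianWindow.toLp = (0 : L2R) from h] at h2
    exact h2.symm.trans (Lp.coeFn_zero ℂ 2 volume)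
  obtain ⟨t, ht⟩ := h1.exists
  simp [gaussianWindow] at ht

/-- Covariance of the short-time Fourier transform under time-frequency shifts. -/
lemma norm_stft_tfShift (φ f : L2R) (w z : ℝ × ℝ) :
    ‖stft φ (tfShift w f) z‖ = ‖stft φ f (z - w)‖ := by
  rw [stft_congr_right φ (tfShift_coeFn w f)]
  have h : stft φ (fun t : ℝ => f (t - w.1) *
      Complex.exp ((2 * Real.pi * w.2 * t : ℝ) * Complex.I)) z =
      Complex.exp ((2 * Real.pi * (w.2 - z.2) * w.1 : ℝ) * Complex.I) * stft φ f (z - w) := by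
    rw [stft, stft, ← integral_const_mul]
    rw [← integral_sub_right_eq_self (fun t => Complex.exp _ * _) w.1]
    refine integral_congr_ae (Filter.Eventually.of_forall fun t => ?_)
    simp only [Prod.fst_sub, Prod.snd_sub, sub_sub_sub_cancel_right]
    have e : Complex.exp ((2 * Real.pi * w.2 * t : ℝ) * Complex.I) *
        Complex.exp (-(2 * Real.pi * z.2 * t : ℝ) * Complex.I) =
        Complex.exp ((2 * Real.pi * (w.2 - z.2) * w.1 : ℝ) * Complex.I) *
        Complex.exp (-(2 * Real.pi * (z.2 - w.2) * (t - w.1) : ℝ) * Complex.I) := by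
      rw [← Complex.exp_add, ← Complex.exp_add]
      congr 1; push_cast; ring
    linear_combination (f (t - w.1) * (starRingEnd ℂ) (φ (t - z.1))) * e
  rw [h, norm_mul, Complex.norm_exp_ofReal_mul_I, one_mul]

/-- Completing the square gives the exact value up to phase, with an additional factor `2^{-1/2}`
that is discarded. -/
lemma norm_stft_gaussianL2_self_le (z : ℝ × ℝ) :
    ‖stft gaussianL2 gaussianL2 z‖ ≤ Real.exp (-(Real.pi / 2) * (z.1 ^ 2 + z.2 ^ 2)) := by
  rw [stft_gaussianL2, gaussianL2, stft_congr_right _ memLp_gaussianWindow.coeFn_toLp, stft]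
  have h : ∀ t : ℝ, gaussianWindow t * (starRingEnd ℂ) (gaussianWindow (t - z.1)) *
      Complex.exp (-(2 * Real.pi * z.2 * t : ℝ) * Complex.I) =
      Complex.exp (((-(2 * Real.pi) : ℝ) : ℂ) * (t : ℂ) ^ 2 +
        (2 * Real.pi * z.1 - 2 * Real.pi * z.2 * Complex.I) * t + (-Real.pi * z.1 ^ 2)) := by
    intro t
    rw [gaussianWindow, gaussianWindow, Complex.conj_ofReal, Complex.ofReal_exp,
      Complex.ofReal_exp, ← Complex.exp_add, ← Complex.exp_add]
    congr 1; push_cast; ring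
  simp only [h]
  rw [integral_cexp_quadratic (by rw [Complex.ofReal_re]; linarith [Real.pi_pos]), norm_mul,
    Complex.norm_exp]
  have hpi : (Real.pi : ℂ) ≠ 0 := by exact_mod_cast Real.pi_ne_zero
  have h1 : ‖((Real.pi : ℂ) / -((-(2 * Real.pi) : ℝ) : ℂ)) ^ (1 / 2 : ℂ)‖ ≤ 1 := by
    have : ((Real.pi : ℂ) / -((-(2 * Real.pi) : ℝ) : ℂ)) = ((1 / 2 : ℝ) : ℂ) := by
      push_cast; field_simp
    rw [this, Complex.norm_cpow_eq_rpow_re_of_pos (by norm_num)]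
    exact Real.rpow_le_one (by norm_num) (by norm_num) (by norm_num)
  have h2 : ((-Real.pi * (z.1 : ℂ) ^ 2) - (2 * Real.pi * z.1 - 2 * Real.pi * z.2 * Complex.I) ^ 2 /
      (4 * ((-(2 * Real.pi) : ℝ) : ℂ))) =
      ((-(Real.pi / 2) * (z.1 ^ 2 + z.2 ^ 2) : ℝ) : ℂ) +
        ((-(Real.pi * z.1 * z.2) : ℝ) : ℂ) * Complex.I := by
    push_cast
    field_simp
    ring_nf
    simp only [Complex.I_sq]
    ring
  rw [h2]
  simp only [Complex.add_re, Complex.ofReal_re, Complex.re_ofReal_mul, Complex.I_re, mul_zero,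
    add_zero]
  exact mul_le_of_le_one_left (Real.exp_pos _).le h1

/-! ### Schur's test and the covering index -/

/-- Schur's test for a finite family of vectors: row sums of the Gram matrix bound the Bessel
constant. -/
lemma sum_norm_inner_sq_le {ι E : Type*} [NormedAddCommGroup E] [InnerProductSpace ℂ E]
    (s : Finset ι) (v : ι → E) {M : ℝ} (hM : 0 ≤ M)
    (h : ∀ i ∈ s, ∑ j ∈ s, ‖inner ℂ (v i) (v j)‖ ≤ M) (f : E) :
    ∑ i ∈ s, ‖inner ℂ (v i) f‖ ^ 2 ≤ M * ‖f‖ ^ 2 := by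
  set c : ι → ℂ := fun i => inner ℂ (v i) f with hc
  set S : ℝ := ∑ i ∈ s, ‖c i‖ ^ 2 with hS
  set u : E := ∑ i ∈ s, c i • v i with hu
  have hS0 : 0 ≤ S := Finset.sum_nonneg fun i _ => by positivity
  have h1 : inner ℂ u f = (S : ℂ) := by
    rw [hu, sum_inner, hS, Complex.ofReal_sum]
    refine Finset.sum_congr rfl fun i _ => ?_
    rw [inner_smul_left, Complex.conj_mul', Complex.ofReal_pow]
  have h2 : S ≤ ‖u‖ * ‖f‖ := by
    calc S = ‖inner ℂ u f‖ := by rw [h1, Complex.norm_real, Real.norm_of_nonneg hS0]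
      _ ≤ _ := norm_inner_le_norm _ _
  have h3 : ‖u‖ ^ 2 ≤ M * S := by
    have e1 : ‖u‖ ^ 2 = ‖inner ℂ u u‖ := by
      rw [inner_self_eq_norm_sq_to_K]; simp
    have e2 : ‖inner ℂ u u‖ ≤ ∑ i ∈ s, ∑ j ∈ s, ‖c i‖ * ‖c j‖ * ‖inner ℂ (v i) (v j)‖ := by
      nth_rewrite 1 [hu]
      rw [sum_inner]
      refine (norm_sum_le _ _).trans (Finset.sum_le_sum fun i _ => ?_)
      rw [hu, inner_sum]
      refine (norm_sum_le _ _).trans (Finset.sum_le_sum fun j _ => ?_)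
      rw [inner_smul_left, inner_smul_right, norm_mul, norm_mul, RCLike.norm_conj, mul_assoc]
    -- `2ab ≤ a² + b²` separates the coefficients; each half is then a weighted sum of row sums of
    -- the Gram matrix.
    have e3 : ∑ i ∈ s, ∑ j ∈ s, ‖c i‖ * ‖c j‖ * ‖inner ℂ (v i) (v j)‖ ≤
        ∑ i ∈ s, ∑ j ∈ s, (‖c i‖ ^ 2 * ‖inner ℂ (v i) (v j)‖ / 2 +
          ‖c j‖ ^ 2 * ‖inner ℂ (v j) (v i)‖ / 2) := by
      refine Finset.sum_le_sum fun i _ => Finset.sum_le_sum fun j _ => ?_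
      rw [norm_inner_symm (v j) (v i)]
      nlinarith [mul_nonneg (sq_nonneg (‖c i‖ - ‖c j‖)) (norm_nonneg (inner ℂ (v i) (v j)))]
    have e4 : ∑ i ∈ s, ∑ j ∈ s, ‖c i‖ ^ 2 * ‖inner ℂ (v i) (v j)‖ / 2 ≤ M * S / 2 := by
      rw [hS, Finset.mul_sum, Finset.sum_div]
      refine Finset.sum_le_sum fun i hi => ?_
      rw [← Finset.sum_div, ← Finset.mul_sum, mul_comm M]
      gcongr
      exact h i hi
    have e5 : ∑ i ∈ s, ∑ j ∈ s, ‖c j‖ ^ 2 * ‖inner ℂ (v j) (v i)‖ / 2 ≤ M * S / 2 := by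
      rw [Finset.sum_comm]; exact e4
    rw [e1]
    refine e2.trans (e3.trans ?_)
    simp only [Finset.sum_add_distrib]
    linarith
  rcases hS0.eq_or_lt with hS' | hS'
  · rw [← hS']; positivity
  · have h4 : S * S ≤ S * (M * ‖f‖ ^ 2) :=
      calc S * S ≤ (‖u‖ * ‖f‖) * (‖u‖ * ‖f‖) := mul_self_le_mul_self hS0 h2
        _ = ‖u‖ ^ 2 * ‖f‖ ^ 2 := by ring
        _ ≤ M * S * ‖f‖ ^ 2 := by gcongr
        _ = S * (M * ‖f‖ ^ 2) := by ring
    exact le_of_mul_le_mul_left h4 hS'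

/-- A supremum in `ℕ` defaults to 0 when unbounded; the bound `Λ.card` makes it a genuine one. -/
lemma card_le_coveringIndex (Λ : Finset (ℝ × ℝ)) (m : ℤ × ℤ) :
    ((Λ : Set (ℝ × ℝ)) ∩ unitSquare m).ncard ≤ coveringIndex Λ := by
  refine le_ciSup (f := fun m : ℤ × ℤ => ((Λ : Set (ℝ × ℝ)) ∩ unitSquare m).ncard)
    ⟨Λ.card, ?_⟩ m
  rintro _ ⟨k, rfl⟩
  rw [← Set.ncard_coe_finset]
  exact Set.ncard_le_ncard Set.inter_subset_left Λ.finite_toSet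

lemma mem_unitSquare_round (z : ℝ × ℝ) : z ∈ unitSquare (round z.1, round z.2) := by
  have h1 := abs_le.1 (abs_sub_round z.1)
  have h2 := abs_le.1 (abs_sub_round z.2)
  simp only [unitSquare, Set.mem_prod, Set.mem_Icc]
  refine ⟨⟨?_, ?_⟩, ?_, ?_⟩ <;> linarith

/-- Rounding changes `a - b` by at most 1, so the squared integer difference is at most `2(a - b)² +
2`: the exponent halves, at the price of `e^{π/2}`. -/
lemma exp_neg_sq_sub_le (a b : ℝ) :
    Real.exp (-(Real.pi / 2) * (a - b) ^ 2) ≤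
      Real.exp (Real.pi / 2) * Real.exp (-(Real.pi / 4) * ((round a - round b : ℤ) : ℝ) ^ 2) := by
  rw [← Real.exp_add, Real.exp_le_exp]
  have h1 := abs_le.1 (abs_sub_round a)
  have h2 := abs_le.1 (abs_sub_round b)
  push_cast
  have h3 : ((round a : ℝ) - round b) ^ 2 ≤ 2 * (a - b) ^ 2 + 2 := by
    have : ((round a : ℝ) - round b - (a - b)) ^ 2 ≤ 1 :=
      (sq_le_one_iff_abs_le_one _).2 (abs_le.2 ⟨by linarith, by linarith⟩)
    nlinarith [sq_nonneg (((round a : ℝ) - round b) - 2 * (a - b))]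
  nlinarith [Real.pi_pos]

/-- On integers `k² ≥ |k|`, and `π/4 > 1/2`, so geometric series dominate. -/
lemma summable_exp_neg_int_sq :
    Summable fun k : ℤ => Real.exp (-(Real.pi / 4) * (k : ℝ) ^ 2) := by
  refine Summable.of_nonneg_of_le (fun _ => (Real.exp_pos _).le) (fun k => ?_)
    (Summable.of_nat_of_neg (f := fun k : ℤ => Real.exp (-|(k : ℝ)| / 2)) ?_ ?_)
  · rw [Real.exp_le_exp]
    have h : |(k : ℝ)| ≤ (k : ℝ) ^ 2 := by
      rw [← sq_abs]
      have : |k| ≤ |k| ^ 2 := by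
        rcases eq_or_ne k 0 with rfl | hk
        · simp
        · exact le_self_pow₀ (Int.one_le_abs hk) two_ne_zero
      exact_mod_cast this
    nlinarith [Real.pi_gt_three, abs_nonneg (k : ℝ)]
  all_goals
    simp only [Int.cast_neg, abs_neg, Int.cast_natCast, Nat.abs_cast]
    refine (Real.summable_exp_nat_mul_iff (a := -(1 / 2))).2 (by norm_num) |>.congr fun n => ?_
    congr 1; ring

/-- The Gaussian row sums over a finite set are controlled by its covering index. -/
lemma exists_sum_gaussian_le : ∃ M : ℝ, 0 < M ∧ ∀ (Λ : Finset (ℝ × ℝ)) (w : ℝ × ℝ),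
    ∑ z ∈ Λ, Real.exp (-(Real.pi / 2) * ((z.1 - w.1) ^ 2 + (z.2 - w.2) ^ 2)) ≤
      M * coveringIndex Λ := by
  set g : ℤ → ℝ := fun k => Real.exp (Real.pi / 2) * Real.exp (-(Real.pi / 4) * (k : ℝ) ^ 2)
    with hg
  have hg0 : ∀ k, 0 < g k := fun k => by positivity
  have hgs : Summable g := summable_exp_neg_int_sq.mul_left _
  have hGs : Summable fun p : ℤ × ℤ => g p.1 * g p.2 :=
    hgs.mul_of_nonneg hgs (fun k => (hg0 k).le) (fun k => (hg0 k).le)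
  refine ⟨∑' p : ℤ × ℤ, g p.1 * g p.2,
    hGs.tsum_pos (fun p => (mul_pos (hg0 _) (hg0 _)).le) (0, 0) (mul_pos (hg0 _) (hg0 _)),
    fun Λ w => ?_⟩
  let r : ℝ × ℝ → ℤ × ℤ := fun z => (round z.1, round z.2)
  -- Points with `q z = p` lie in the unit square centred at `p + r w`, so each fibre has at most
  -- `coveringIndex Λ` elements, whatever `w` is.
  let q : ℝ × ℝ → ℤ × ℤ := fun z => r z - r w
  calc ∑ z ∈ Λ, Real.exp (-(Real.pi / 2) * ((z.1 - w.1) ^ 2 + (z.2 - w.2) ^ 2))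
      ≤ ∑ z ∈ Λ, g (q z).1 * g (q z).2 := by
        refine Finset.sum_le_sum fun z _ => ?_
        rw [mul_add, Real.exp_add]
        exact mul_le_mul (exp_neg_sq_sub_le _ _) (exp_neg_sq_sub_le _ _) (Real.exp_pos _).le
          (hg0 _).le
    _ = ∑ p ∈ Λ.image q, ∑ z ∈ Λ with q z = p, g (q z).1 * g (q z).2 :=
        (Finset.sum_fiberwise_of_maps_to (fun z hz => Finset.mem_image_of_mem q hz) _).symm
    _ ≤ ∑ p ∈ Λ.image q, g p.1 * g p.2 * coveringIndex Λ := by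
        refine Finset.sum_le_sum fun p _ => ?_
        have h1 : ∑ z ∈ Λ with q z = p, g (q z).1 * g (q z).2 =
            ((Λ.filter fun z => q z = p).card : ℝ) * (g p.1 * g p.2) := by
          rw [← nsmul_eq_mul, ← Finset.sum_const]
          refine Finset.sum_congr rfl fun z hz => ?_
          rw [(Finset.mem_filter.1 hz).2]
        rw [h1, mul_comm]
        have h2 : (Λ.filter fun z => q z = p).card ≤ coveringIndex Λ := by
          refine le_trans ?_ (card_le_coveringIndex Λ (p + r w))
          rw [← Set.ncard_coe_finset]
          refine Set.ncard_le_ncard (fun z hz => ?_) (Λ.finite_toSet.inter_of_left _)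
          rw [Finset.mem_coe, Finset.mem_filter] at hz
          refine ⟨hz.1, ?_⟩
          rw [← hz.2]
          simpa [q] using mem_unitSquare_round z
        have := (mul_pos (hg0 p.1) (hg0 p.2)).le
        gcongr
    _ = (∑ p ∈ Λ.image q, g p.1 * g p.2) * coveringIndex Λ := by rw [Finset.sum_mul]
    _ ≤ _ := by
        gcongr
        exact hGs.sum_le_tsum _ fun p _ => (mul_pos (hg0 _) (hg0 _)).le

/-- The Bessel bound for the Gaussian window, uniformly over translates of the sampling set. -/
lemma exists_bessel_gaussianL2 : ∃ M : ℝ, 0 < M ∧ ∀ (Λ : Finset (ℝ × ℝ)) (w : ℝ × ℝ) (f : L2R),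
    ∑ z ∈ Λ, ‖stft gaussianL2 f (z + w)‖ ^ 2 ≤ M * coveringIndex Λ * ‖f‖ ^ 2 := by
  obtain ⟨M, hM, h⟩ := exists_sum_gaussian_le
  refine ⟨M, hM, fun Λ w f => ?_⟩
  simp only [stft_eq_inner]
  refine sum_norm_inner_sq_le Λ (fun z => tfShift (z + w) gaussianL2) (by positivity)
    (fun y _ => ?_) f
  refine le_trans (Finset.sum_le_sum fun z _ => ?_) (h Λ y)
  -- By covariance the common translation `w` cancels from the Gram entries.
  rw [norm_inner_symm, ← stft_eq_inner, norm_stft_tfShift, add_sub_add_right_eq_sub]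
  exact norm_stft_gaussianL2_self_le (z - y)

/-! ### From the Gaussian to windows in Feichtinger's algebra -/

/-- The polarized form of Moyal's identity. -/
lemma integral_conj_stft_mul_stft (φ f g : L2R) :
    ∫ z, (starRingEnd ℂ) (stft φ f z) * stft φ g z = (‖φ‖ ^ 2 : ℝ) * inner ℂ f g := by
  have hm : ∀ f : L2R, MemLp (stft φ f) 2 := fun f =>
    (memLp_two_iff_integrable_sq_norm (continuous_stft φ f).aestronglyMeasurable).2
      (integrable_stft_sq φ f)
  let T : L2R → Lp ℂ 2 (volume : Measure (ℝ × ℝ)) := fun f => (hm f).toLp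
  have hadd : ∀ f g, T (f + g) = T f + T g := fun f g => by
    rw [← MemLp.toLp_add]
    exact MemLp.toLp_congr _ _ (Filter.Eventually.of_forall fun z => stft_add φ f g z)
  have hsmul : ∀ (c : ℂ) f, T (c • f) = c • T f := fun c f => by
    rw [← MemLp.toLp_const_smul]
    exact MemLp.toLp_congr _ _ (Filter.Eventually.of_forall fun z => stft_smul φ f c z)
  let L : L2R →ₗ[ℂ] Lp ℂ 2 (volume : Measure (ℝ × ℝ)) :=
    { toFun := T, map_add' := hadd, map_smul' := hsmul }
  have hinner : ∀ f g, inner ℂ (L f) (L g) = ∫ z, (starRingEnd ℂ) (stft φ f z) * stft φ g z := by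
    intro f g
    rw [L2.inner_def]
    refine integral_congr_ae ?_
    filter_upwards [(hm f).coeFn_toLp, (hm g).coeFn_toLp] with z h1 h2
    rw [RCLike.inner_apply, mul_comm]
    change (starRingEnd ℂ) (((hm f).toLp) z) * ((hm g).toLp) z = _
    rw [h1, h2]
  have hnorm : ∀ f, ‖L f‖ = ‖φ‖ * ‖f‖ := by
    intro f
    have h1 : ‖L f‖ ^ 2 = (‖φ‖ * ‖f‖) ^ 2 := by
      have h2 : ((‖L f‖ ^ 2 : ℝ) : ℂ) = ((‖f‖ ^ 2 * ‖φ‖ ^ 2 : ℝ) : ℂ) := by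
        rw [← integral_stft_sq, ← integral_complex_ofReal, Complex.ofReal_pow]
        refine (inner_self_eq_norm_sq_to_K (𝕜 := ℂ) (L f)).symm.trans ?_
        rw [hinner]
        simp [Complex.conj_mul']
      rw [Complex.ofReal_inj.1 h2]; ring
    exact (pow_left_inj₀ (norm_nonneg _) (by positivity) two_ne_zero).1 h1
  -- `L` multiplies norms by `‖φ‖`, so polarization determines its inner products.
  rw [← hinner, inner_eq_sum_norm_sq_div_four, inner_eq_sum_norm_sq_div_four f g]
  simp only [← map_smul, ← map_add, ← map_sub, hnorm]
  simp only [RCLike.ofReal_eq_complex_ofReal]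
  push_cast
  ring

/-- Cauchy–Schwarz for the weight `k`: the quadratic `t ↦ ∫ k (h - t)²` is nonnegative, so its
discriminant is not positive. -/
lemma sq_integral_mul_le {X : Type*} [MeasurableSpace X] {μ : Measure X} {k h : X → ℝ}
    (hk0 : ∀ x, 0 ≤ k x) (hk : Integrable k μ) (hkh : Integrable (fun x => k x * h x) μ)
    (hkh2 : Integrable (fun x => k x * h x ^ 2) μ) :
    (∫ x, k x * h x ∂μ) ^ 2 ≤ (∫ x, k x ∂μ) * ∫ x, k x * h x ^ 2 ∂μ := by
  have hq : ∀ t : ℝ, 0 ≤ (∫ x, k x ∂μ) * (t * t) + (-2 * ∫ x, k x * h x ∂μ) * t +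
      ∫ x, k x * h x ^ 2 ∂μ := by
    intro t
    have h1 : (∫ x, k x ∂μ) * (t * t) + (-2 * ∫ x, k x * h x ∂μ) * t + ∫ x, k x * h x ^ 2 ∂μ =
        ∫ x, k x * (h x - t) ^ 2 ∂μ := by
      have e : ∀ x, k x * (h x - t) ^ 2 =
          k x * (t * t) + k x * h x * (-2 * t) + k x * h x ^ 2 := fun x => by ring
      simp only [e]
      rw [integral_add (f := fun x => k x * (t * t) + k x * h x * (-2 * t))
        ((hk.mul_const _).add (hkh.mul_const _)) hkh2,
        integral_add (hk.mul_const _) (hkh.mul_const _), integral_mul_const, integral_mul_const]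
      ring
    rw [h1]
    exact integral_nonneg fun x => mul_nonneg (hk0 x) (sq_nonneg _)
  have := discrim_le_zero hq
  rw [discrim] at this
  nlinarith

/-- Pointwise domination of the short-time Fourier transform with window `φ` by the one with
Gaussian window. -/
lemma norm_stft_le_integral (φ f : L2R) (w : ℝ × ℝ) :
    ‖gaussianL2‖ ^ 2 * ‖stft φ f w‖ ≤
      ∫ z, ‖stft gaussianL2 φ z‖ * ‖stft gaussianL2 f (w + z)‖ := by
  -- Since `V_φ f(w) = ⟨f, π(w)φ⟩`, Moyal with the Gaussian window expresses it through Gaussian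
  -- transforms.
  have h := integral_conj_stft_mul_stft gaussianL2 (tfShift w φ) f
  rw [← stft_eq_inner] at h
  calc ‖gaussianL2‖ ^ 2 * ‖stft φ f w‖
      = ‖∫ z, (starRingEnd ℂ) (stft gaussianL2 (tfShift w φ) z) * stft gaussianL2 f z‖ := by
        rw [h, norm_mul, Complex.norm_real, Real.norm_of_nonneg (by positivity)]
    _ ≤ ∫ z, ‖(starRingEnd ℂ) (stft gaussianL2 (tfShift w φ) z) * stft gaussianL2 f z‖ :=
        norm_integral_le_integral_norm _
    _ = ∫ z, ‖stft gaussianL2 φ (z - w)‖ * ‖stft gaussianL2 f (w + (z - w))‖ := by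
        refine integral_congr_ae (Filter.Eventually.of_forall fun z => ?_)
        simp only [norm_mul, RCLike.norm_conj, norm_stft_tfShift, add_sub_cancel]
    _ = _ := integral_sub_right_eq_self
        (fun z => ‖stft gaussianL2 φ z‖ * ‖stft gaussianL2 f (w + z)‖) w

/-- For a window in Feichtinger's algebra, the Bessel bound is proportional to the covering
index. -/
theorem exists_isBesselBound_coveringIndex {φ : L2R} (hφ : MemFeichtinger φ) :
    ∃ C : ℝ, 0 < C ∧ ∀ Λ : Finset (ℝ × ℝ), IsBesselBound φ Λ (C * coveringIndex Λ) := by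
  obtain ⟨M, hM, hb⟩ := exists_bessel_gaussianL2
  rw [MemFeichtinger, ← stft_gaussianL2] at hφ
  set G := ‖gaussianL2‖ ^ 2 with hG
  have hG0 : 0 < G := pow_pos norm_gaussianL2_pos 2
  set k : ℝ × ℝ → ℝ := fun z => ‖stft gaussianL2 φ z‖ with hkdef
  set A := ∫ z, k z with hA
  have hA0 : 0 ≤ A := integral_nonneg fun z => norm_nonneg _
  -- The `+ 1` gives positivity without having to show `A ≠ 0`.
  refine ⟨(A / G) ^ 2 * M + 1, by positivity, fun Λ f => ?_⟩
  have hshift : ∀ w, Continuous fun z => ‖stft gaussianL2 f (w + z)‖ := fun w =>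
    ((continuous_stft gaussianL2 f).comp (continuous_const.add continuous_id)).norm
  have hint : ∀ (n : ℕ) (w : ℝ × ℝ),
      Integrable fun z => k z * ‖stft gaussianL2 f (w + z)‖ ^ n := fun n w =>
    hφ.norm.mul_bdd (c := (‖gaussianL2‖ * ‖f‖) ^ n) ((hshift w).pow n).aestronglyMeasurable
      (Filter.Eventually.of_forall fun z => by
        rw [norm_pow, norm_norm]
        exact pow_le_pow_left₀ (norm_nonneg _) (norm_stft_le _ _ _) n)
  have hpt : ∀ w, G ^ 2 * ‖stft φ f w‖ ^ 2 ≤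
      A * ∫ z, k z * ‖stft gaussianL2 f (w + z)‖ ^ 2 := by
    intro w
    have h1 := norm_stft_le_integral φ f w
    have h2 := sq_integral_mul_le (k := k) (h := fun z => ‖stft gaussianL2 f (w + z)‖)
      (fun z => norm_nonneg _) hφ.norm (by simpa using hint 1 w) (hint 2 w)
    rw [← mul_pow]
    exact (pow_le_pow_left₀ (by positivity) h1 2).trans h2
  have hsum : G ^ 2 * ∑ w ∈ Λ, ‖stft φ f w‖ ^ 2 ≤
      A * (A * (M * coveringIndex Λ * ‖f‖ ^ 2)) := by
    calc G ^ 2 * ∑ w ∈ Λ, ‖stft φ f w‖ ^ 2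
        ≤ ∑ w ∈ Λ, A * ∫ z, k z * ‖stft gaussianL2 f (w + z)‖ ^ 2 := by
          rw [Finset.mul_sum]
          exact Finset.sum_le_sum fun w _ => hpt w
      _ = A * ∫ z, k z * ∑ w ∈ Λ, ‖stft gaussianL2 f (w + z)‖ ^ 2 := by
          rw [← Finset.mul_sum, ← integral_finsetSum _ fun w _ => hint 2 w]
          simp only [Finset.mul_sum]
      _ ≤ A * ∫ z, k z * (M * coveringIndex Λ * ‖f‖ ^ 2) := by
          refine mul_le_mul_of_nonneg_left ?_ hA0
          refine integral_mono ?_ (hφ.norm.mul_const _) fun z => ?_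
          · simp only [Finset.mul_sum]
            exact integrable_finsetSum _ fun w _ => hint 2 w
          · exact mul_le_mul_of_nonneg_left (hb Λ z f) (norm_nonneg _)
      _ = _ := by rw [integral_mul_const]
  have hX : 0 ≤ (coveringIndex Λ : ℝ) * ‖f‖ ^ 2 := by positivity
  have : ∑ w ∈ Λ, ‖stft φ f w‖ ^ 2 ≤ (A / G) ^ 2 * M * (coveringIndex Λ * ‖f‖ ^ 2) := by
    rw [div_pow, div_mul_eq_mul_div, div_mul_eq_mul_div, le_div_iff₀ (by positivity)]
    linarith
  linarith

/-! ### Least squares and concentration -/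

/-- A finite least squares problem over a subspace always has a solution. -/
lemma exists_isLeastSquaresSolution (φ : L2R) (Λ : Finset (ℝ × ℝ)) (V : Submodule ℂ L2R)
    (f : L2R) : ∃ p : L2R, IsLeastSquaresSolution φ Λ V f p := by
  let T : L2R →ₗ[ℂ] EuclideanSpace ℂ Λ :=
    { toFun := fun g => WithLp.toLp 2 fun z : Λ => stft φ g z
      map_add' := fun g h => by ext z; exact stft_add φ g h z
      map_smul' := fun c g => by ext z; exact stft_smul φ g c z }
  have hT : ∀ g, ‖T f - T g‖ ^ 2 = sampleResidual φ Λ f g := by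
    intro g
    rw [EuclideanSpace.norm_sq_eq, sampleResidual,
      ← Finset.sum_coe_sort Λ (fun z => ‖stft φ f z - stft φ g z‖ ^ 2)]
    rfl
  -- The samples of `V` form a subspace of a finite-dimensional space, so the nearest sample vector
  -- exists; any preimage in `V` is a minimizer.
  have hmem : (V.map T).starProjection (T f) ∈ V.map T := Submodule.starProjection_apply_mem _ _
  obtain ⟨p, hp, hpT⟩ := hmem
  refine ⟨p, hp, fun q hq => ?_⟩
  rw [← hT, ← hT]
  refine pow_le_pow_left₀ (norm_nonneg _) ?_ 2
  rw [hpT, Submodule.starProjection_minimal]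
  exact ciInf_le ⟨0, by rintro _ ⟨w, rfl⟩; exact norm_nonneg _⟩
    (⟨T q, Submodule.mem_map_of_mem hq⟩ : V.map T)

/-- A concentrated function is close to the span of the leading eigenfunctions. -/
lemma exists_mem_eigenSpan_norm_sub_sq_le {φ : L2R} (hφ1 : ‖φ‖ = 1) {Ω : Set (ℝ × ℝ)}
    (hΩ : IsCompact Ω) {α : ℕ → ℝ} {ψ : ℕ → L2R} (h : IsEigenEnumeration Ω φ α ψ) (N : ℕ)
    {γ : ℝ} (hγ : α N ≤ γ) {ε : ℝ} {f : L2R} (hf : IsConcentrated ε φ Ω f) :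
    ∃ p ∈ eigenSpan ψ N, (1 - γ) * ‖f - p‖ ^ 2 ≤ ε * ‖f‖ ^ 2 := by
  set V := eigenSpan ψ N with hV
  have hfin : FiniteDimensional ℂ V :=
    FiniteDimensional.span_of_finite ℂ ((Set.finite_Iio N).image ψ)
  set H := locOpCLM Ω φ with hH
  have heig : ∀ k, H (ψ k) = (α k : ℂ) • ψ k := fun k => by
    rw [hH, locOpCLM_apply hΩ]; exact h.eigen k
  have hinv : ∀ v ∈ V, H v ∈ V := by
    intro v hv
    have hle : V ≤ V.comap (H : L2R →ₗ[ℂ] L2R) := by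
      conv_lhs => rw [hV, eigenSpan]
      rw [Submodule.span_le]
      rintro _ ⟨k, hk, rfl⟩
      change H (ψ k) ∈ V
      rw [heig]
      exact V.smul_mem _ (Submodule.subset_span ⟨k, hk, rfl⟩)
    exact hle hv
  set p : L2R := V.starProjection f with hp
  have hpV : p ∈ V := Submodule.starProjection_apply_mem _ _
  set g : L2R := f - p with hg
  have hgV : g ∈ Vᗮ := Submodule.sub_starProjection_mem_orthogonal f
  have horth : ∀ v ∈ V, inner ℂ v g = 0 :=
    fun v hv => Submodule.inner_right_of_mem_orthogonal hv hgV
  have horth' : ∀ v ∈ V, inner ℂ g v = 0 :=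
    fun v hv => Submodule.inner_left_of_mem_orthogonal hv hgV
  have hfpg : f = p + g := by rw [hg]; abel
  have hnorm : ‖f‖ ^ 2 = ‖p‖ ^ 2 + ‖g‖ ^ 2 := by
    rw [hfpg, sq, sq, sq]
    exact norm_add_sq_eq_norm_sq_add_norm_sq_of_inner_eq_zero p g (horth p hpV)
  have hcross : inner ℂ p (H g) = 0 := by
    rw [show inner ℂ p (H g) = inner ℂ (H p) g from (isSymmetric_locOpCLM hΩ φ p g).symm]
    exact horth _ (hinv p hpV)
  have hsplit : inner ℂ f (H f) = inner ℂ p (H p) + inner ℂ g (H g) := by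
    rw [hfpg, map_add, inner_add_left, inner_add_right, inner_add_right, hcross,
      horth' _ (hinv p hpV), add_zero, zero_add]
  have hHp : (inner ℂ p (H p)).re ≤ ‖p‖ ^ 2 := by
    simpa [hφ1] using re_inner_locOpCLM_le hΩ φ p
  have hHg : (inner ℂ g (H g)).re ≤ α N * ‖g‖ ^ 2 := by
    -- With indices from 0, `V` is spanned by `ψ 0, …, ψ (N - 1)` and `α N` is the eigenvalue
    -- `α_{N+1}` of the literature.
    refine re_inner_le_of_orthogonal (isCompactOperator_locOpCLM hΩ φ) (isSymmetric_locOpCLM hΩ φ)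
      (re_inner_locOpCLM_nonneg hΩ φ) h.pos h.antitone heig (fun μ g hμ hg => ?_) N
      (fun k hk => horth _ (Submodule.subset_span ⟨k, hk, rfl⟩))
    rw [locOpCLM_apply hΩ] at hg
    exact h.exhaustive μ g hμ hg
  have hconc : (1 - ε) * ‖f‖ ^ 2 ≤ (inner ℂ f (H f)).re := by
    rw [hH, locOpCLM_apply hΩ]; exact hf
  rw [hsplit, Complex.add_re] at hconc
  refine ⟨p, hpV, ?_⟩
  have hγg := mul_le_mul_of_nonneg_right hγ (sq_nonneg ‖g‖)
  -- Substituting `‖p‖² = ‖f‖² - ‖g‖²` into `(1 - ε)‖f‖² ≤ ‖p‖² + γ‖g‖²` gives the claim.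
  linarith

end TFSampling

theorem mainTheorem6 (φ : L2R) (hφ : MemFeichtinger φ) (hφ1 : ‖φ‖ = 1) :
    ∃ C : ℝ, 0 < C ∧
      ∀ (Ω : Set (ℝ × ℝ)), IsCompact Ω →
      ∀ (Λ : Finset (ℝ × ℝ)), (Λ : Set (ℝ × ℝ)) ⊆ Ω →
        IsBesselBound φ Λ (C * coveringIndex Λ) ∧
        ∀ (B : ℝ), IsBesselBound φ Λ B →
        ∀ (α : ℕ → ℝ) (ψ : ℕ → L2R), IsEigenEnumeration Ω φ α ψ →
        ∀ (N : ℕ), 1 ≤ N →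
        ∀ (γ : ℝ), γ ≤ α (N - 1) → α N ≤ γ → γ < 1 →
        ∀ (ε : ℝ) (f : L2R), IsConcentrated ε φ Ω f →
          (∃ p : L2R, IsLeastSquaresSolution φ Λ (eigenSpan ψ N) f p) ∧
          ∀ p : L2R, IsLeastSquaresSolution φ Λ (eigenSpan ψ N) f p →
            sampleResidual φ Λ f p ≤ B * (ε / (1 - γ)) * ‖f‖ ^ 2 := by
  obtain ⟨C, hC, hbessel⟩ := exists_isBesselBound_coveringIndex hφ
  refine ⟨C, hC, fun Ω hΩ Λ _ => ⟨hbessel Λ, ?_⟩⟩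
  intro B hB α ψ hψ N _ γ _ hγ hγ1 ε f hf
  refine ⟨exists_isLeastSquaresSolution φ Λ _ f, fun p hp => ?_⟩
  obtain ⟨q, hq, hfq⟩ := exists_mem_eigenSpan_norm_sub_sq_le hφ1 hΩ hψ N hγ hf
  -- Testing the Bessel inequality on the unit vector `φ` shows that `B` is nonnegative.
  have hB0 : 0 ≤ B := by
    have h := (Finset.sum_nonneg fun z _ => sq_nonneg ‖stft φ φ z‖).trans (hB φ)
    simpa [hφ1] using h
  have hγ0 : 0 < 1 - γ := by linarith
  calc sampleResidual φ Λ f p ≤ sampleResidual φ Λ f q := hp.2 q hq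
    _ = ∑ z ∈ Λ, ‖stft φ (f - q : L2R) z‖ ^ 2 := by simp only [sampleResidual, stft_sub]
    _ ≤ B * ‖f - q‖ ^ 2 := hB _
    _ ≤ B * (ε / (1 - γ) * ‖f‖ ^ 2) := by
      gcongr
      rw [div_mul_eq_mul_div, le_div_iff₀ hγ0]
      linarith
    _ = B * (ε / (1 - γ)) * ‖f‖ ^ 2 := by ring
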